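/- Let $w:\mathbb N\to\mathbb R$ be a function that tends to infinity. Then there are functions $\delta,\eta:\mathbb N\to\mathbb R$, depending only on $w$, with $\delta(N)\to 0$ and $\eta(N)\to 0$ as $N\to\infty$, such that the following holds for every finite group $\mathbf G$ of exponent $2$ (written additively; such a group is abelian, a vector space over $\mathbb F_2$). Let $A\subseteq\mathbf G$ be a random subset obtained by putting every element of $\mathbf G$ into $A$ independently with probability $\frac12$. Then with probability at least $1-\eta(|\mathbf G|)$, all sets $X,Y\subseteq\mathbf G$ with $$|X|,\,|Y|\ \ge\ w(|\mathbf G|)\,(\log\log|\mathbf G|)\,\log^{3/2}|\mathbf G|$$ satisfy $$\Bigl|\sum_{x\in X}\sum_{y\in Y}1_A(x+y)-\tfrac12|X||Y|\Bigr|\ \le\ \delta(|\mathbf G|)\,|X||Y| ,$$ where $1_A$ is the characteristic function of $A$. In other words, with probability $1-o(1)$ one has $\sum_{x\in X}\sum_{y\in Y}1_A(x+y)=\frac12|X||Y|+o(|X||Y|)$ for all such $X,Y$ as $|\mathbf G|\to\infty$, where the rates of convergence depend only on $w$. That is, in the Cayley sum graph of $A$ (in which $(x,y)$ is an edge iff $x+y\in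 A$), the edge density between $X$ and $Y$ is $\frac12+o(1)$. -/

import Mathlib

/-- The law of the random subset of `G` that contains each element of `G` independently with
probability `1 / 2`. -/
noncomputable def randomSubset (G : Type*) : MeasureTheory.Measure (Set G) :=
  ProbabilityTheory.setBernoulli Set.univ ⟨1 / 2, by norm_num, by norm_num⟩

/-- The number of pairs `(x, y) ∈ X × Y` with `x + y ∈ A`, i.e. of edges from `X` to `Y` in the
Cayley sum graph of `A`, written as the sum over `X × Y` of the characteristic function of `A`. -/
noncomputable def edgeSum {G : Type*} [Add G] (A : Set G) (X Y : Finset G) : ℝ :=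
  ∑ x ∈ X, ∑ y ∈ Y, A.indicator (fun _ => (1 : ℝ)) (x + y)

/-!
The balanced form `2 · 1_A - 1` of `1_A` has independent signs as values, so for fixed `X`, `Y` the
deviation of the edge count is a sum of independent terms whose variance is the additive energy
`E[X, Y]` (`randomSubset_abs_signSum_le`). A union bound over all large `X`, `Y` fails, as there are
too many of them. Instead, a deviating pair `X`, `Y` is replaced by a deviating pair of small subsets
of sizes `a`, `b` whose energy is at most `2 * a * b`
(`exists_subsets_of_le_abs_signSum`); this is possible by averaging as soon as
`E[X, Y] * a * b`, without the trivial coincidences, is small compared with `|X| ^ 2 * |Y| ^ 2`. For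
such pairs the failure probability is `exp (-c * a * b)`, to be compared with the number of pairs.

Let `L = log N` and `d ≈ √L`. Removing independent subsets of size `d` from `X` as long as
possible splits `X` into a union `S` of independent sets and a set `R` of rank at most `d`
(`exists_decomposition`), and one of `S`, `R` carries a deviation.

* For `S`, the energy with `Y` is at most of order `|S| ^ 2 * |Y| * log |Y| / d`. This follows from
  an edge-isoperimetric inequality (`card_edges_le`). It permits `a = b` of order `L`, and the
  number `N ^ (2 * a)` of pairs is negligible against `exp (c * a * b)`.
* For `R`, the trivial energy bound `|R| ^ 2 * |Y|` permits `a` of order `L` and `b` of order `d`.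
  Although `a * b` is only of order `L * d`, a subset of `R` lies in one of `N ^ d` subspaces with
  `2 ^ d` elements, so there are only `N ^ d * 2 ^ (d * a) * N ^ b` pairs.

Both cases need `|Y|` to exceed a large multiple of `L ^ (3 / 2) * log |Y|`, which is the threshold
in the theorem because `log |Y|` is of order `log log N` for `|Y|` near the threshold. This settles
every fixed error `ε` with failure probability at most `1 / N` for large `N`, and a diagonal
choice of `ε` gives the functions `δ` and `η`.
-/

open Finset
open scoped Combinatorics.Additive

/-! ### Concentration of the signed edge count -/

/-- The `±1`-valued balanced form `2 · 1_A - 1` of the characteristic function of `A`. -/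
noncomputable def signFn {G : Type*} (A : Set G) (g : G) : ℝ :=
  open Classical in if g ∈ A then 1 else -1

lemma signFn_eq {G : Type*} (A : Set G) (g : G) :
    signFn A g = 2 * A.indicator (fun _ => (1 : ℝ)) g - 1 := by
  classical
  unfold signFn Set.indicator
  split_ifs <;> norm_num

lemma abs_signFn {G : Type*} (A : Set G) (g : G) : |signFn A g| = 1 := by
  unfold signFn
  split_ifs <;> norm_num

/-- The sum of the balanced function of `A` over all `x + y` with `(x, y) ∈ X × Y`. -/
noncomputable def signSum {G : Type*} [Add G] (A : Set G) (X Y : Finset G) : ℝ :=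
  ∑ x ∈ X, ∑ y ∈ Y, signFn A (x + y)

lemma edgeSum_sub {G : Type*} [Add G] (A : Set G) (X Y : Finset G) :
    edgeSum A X Y - 1 / 2 * ((X.card : ℝ) * (Y.card : ℝ)) = 1 / 2 * signSum A X Y := by
  unfold edgeSum signSum
  simp only [signFn_eq, sum_sub_distrib, ← mul_sum]
  simp
  ring

lemma abs_signSum_le {G : Type*} [Add G] (A : Set G) (X Y : Finset G) :
    |signSum A X Y| ≤ X.card * Y.card := by
  unfold signSum
  refine (abs_sum_le_sum_abs _ _).trans ?_
  refine (sum_le_sum fun x _ => abs_sum_le_sum_abs _ _).trans ?_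
  simp [abs_signFn]

/-- The random subset is uniformly distributed. The sum over finsets is over all subsets of `G`. -/
lemma randomSubset_real_le {G : Type*} [Fintype G] (S : Set (Set G)) :
    (randomSubset G).real S ≤
      ∑ T : Finset G, S.indicator (fun _ => (1 : ℝ)) (T : Set G) * (1 / 2) ^ Fintype.card G := by
  classical
  have hsub : S = ⋃ T ∈ (univ.filter fun T : Finset G => (T : Set G) ∈ S),
      ({(T : Set G)} : Set (Set G)) := by
    ext A
    simp only [mem_filter, mem_univ, true_and, Set.mem_iUnion, Set.mem_singleton_iff, exists_prop]
    constructor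
    · intro h
      exact ⟨A.toFinite.toFinset, by simpa using h, by simp⟩
    · rintro ⟨T, hT, rfl⟩
      exact hT
  have hone (T : Finset G) :
      (randomSubset G).real {(T : Set G)} = (1 / 2) ^ Fintype.card G := by
    unfold randomSubset
    rw [ProbabilityTheory.setBernoulli_real_singleton _ (Set.subset_univ _) Set.finite_univ]
    have h1 : (1 : ℝ) - 1 / 2 = 1 / 2 := by norm_num
    simp only [h1]
    rw [← pow_add, add_comm, Set.ncard_sdiff_add_ncard_of_subset (Set.subset_univ _),
      Set.ncard_univ, Nat.card_eq_fintype_card]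
  conv_lhs => rw [hsub]
  refine (MeasureTheory.measureReal_biUnion_finset_le _ _).trans ?_
  rw [sum_filter]
  refine sum_le_sum fun T _ => ?_
  by_cases h : (T : Set G) ∈ S <;> simp [h, hone]

instance isProbabilityMeasure_randomSubset (G : Type*) :
    MeasureTheory.IsProbabilityMeasure (randomSubset G) := by
  unfold randomSubset
  infer_instance

lemma sum_exp_signFn {G : Type*} [Fintype G] (r : G → ℝ) :
    ∑ T : Finset G, Real.exp (∑ g, r g * signFn (T : Set G) g) * (1 / 2) ^ Fintype.card G =
      ∏ g, Real.cosh (r g) := by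
  classical
  have h1 : ∏ g, Real.cosh (r g) =
      ∏ g, (Real.exp (r g) * (1 / 2) + Real.exp (-r g) * (1 / 2)) := by
    refine prod_congr rfl fun g _ => ?_
    rw [Real.cosh_eq]; ring
  rw [h1, prod_add, powerset_univ]
  refine sum_congr rfl fun T _ => ?_
  rw [prod_mul_distrib, prod_mul_distrib, mul_mul_mul_comm, prod_const, prod_const, ← pow_add,
    card_sdiff_of_subset (subset_univ T), card_univ, Nat.add_sub_cancel' (card_le_univ T),
    ← Real.exp_sum, ← Real.exp_sum, ← Real.exp_add, ← sum_sdiff (subset_univ T), add_comm]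
  congr 3
  · refine sum_congr rfl fun g hg => ?_
    simp [signFn, hg]
  · refine sum_congr rfl fun g hg => ?_
    have : g ∉ T := (mem_sdiff.1 hg).2
    simp [signFn, this]

/-- Hoeffding's inequality for a weighted sum of the independent signs of a random subset. -/
lemma randomSubset_hoeffding {G : Type*} [Fintype G] (r : G → ℝ) {t V : ℝ}
    (ht : 0 ≤ t) (hV : 0 < V) (hr : ∑ g, r g ^ 2 ≤ V) :
    (randomSubset G).real {A | t ≤ ∑ g, r g * signFn A g} ≤ Real.exp (-(t ^ 2 / (2 * V))) := by
  classical
  set s : ℝ := t / V with hs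
  have hs0 : 0 ≤ s := by positivity
  calc (randomSubset G).real {A | t ≤ ∑ g, r g * signFn A g}
      ≤ _ := randomSubset_real_le _
    _ ≤ ∑ T : Finset G, Real.exp (-(s * t)) *
          (Real.exp (∑ g, (s * r g) * signFn (T : Set G) g) * (1 / 2) ^ Fintype.card G) := by
        refine sum_le_sum fun T _ => ?_
        rw [← mul_assoc, ← Real.exp_add]
        refine mul_le_mul_of_nonneg_right ?_ (by positivity)
        rw [Set.indicator_apply]
        split_ifs with h
        · refine Real.one_le_exp ?_
          simp only [mul_assoc, ← mul_sum]
          have := mul_le_mul_of_nonneg_left (Set.mem_ofPred_eq ▸ h) hs0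
          linarith
        · positivity
    _ = Real.exp (-(s * t)) * ∏ g, Real.cosh (s * r g) := by
        rw [← mul_sum, sum_exp_signFn]
    _ ≤ Real.exp (-(s * t)) * Real.exp (s ^ 2 * V / 2) := by
        gcongr
        calc ∏ g, Real.cosh (s * r g) ≤ ∏ g, Real.exp ((s * r g) ^ 2 / 2) :=
              prod_le_prod (fun g _ => (Real.cosh_pos _).le)
                fun g _ => Real.cosh_le_exp_half_sq _
          _ = Real.exp (s ^ 2 * (∑ g, r g ^ 2) / 2) := by
              rw [← Real.exp_sum, mul_sum, sum_div]
              simp only [mul_pow]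
          _ ≤ _ := by gcongr
    _ = Real.exp (-(t ^ 2 / (2 * V))) := by
        rw [← Real.exp_add, hs]
        congr 1
        field_simp
        ring

/-- The variance of the signed edge count is the additive energy. -/
lemma randomSubset_abs_signSum_le {G : Type*} [AddGroup G] [Fintype G] [DecidableEq G]
    (X Y : Finset G) {t V : ℝ} (ht : 0 ≤ t) (hV : 0 < V) (hE : (E[X, Y] : ℝ) ≤ V) :
    (randomSubset G).real {A | t ≤ |signSum A X Y|} ≤ 2 * Real.exp (-(t ^ 2 / (2 * V))) := by
  classical
  set r : G → ℝ := fun g => (#{p ∈ X ×ˢ Y | p.1 + p.2 = g} : ℝ) with hrdef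
  have hsum (A : Set G) : signSum A X Y = ∑ g, r g * signFn A g := by
    unfold signSum
    rw [← sum_product', ← sum_fiberwise (X ×ˢ Y) (fun p => p.1 + p.2)]
    refine sum_congr rfl fun g _ => ?_
    rw [sum_congr rfl (g := fun _ => signFn A g)]
    · simp [hrdef]
    · intro p hp
      rw [(mem_filter.1 hp).2]
  have hr2 : ∑ g, r g ^ 2 ≤ V := by
    refine le_trans (le_of_eq ?_) hE
    rw [Finset.addEnergy_eq_sum_sq]
    push_cast
    rfl
  have hr2' : ∑ g, (-r) g ^ 2 ≤ V := by simpa using hr2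
  have hsub : {A : Set G | t ≤ |signSum A X Y|} ⊆
      {A | t ≤ ∑ g, r g * signFn A g} ∪ {A | t ≤ ∑ g, (-r) g * signFn A g} := by
    intro A hA
    rcases le_abs.1 (show t ≤ |signSum A X Y| from hA) with h | h
    · left
      simpa [hsum] using h
    · right
      simpa [hsum] using h
  refine (MeasureTheory.measureReal_mono hsub).trans ?_
  refine (MeasureTheory.measureReal_union_le _ _).trans ?_
  have h1 := randomSubset_hoeffding r ht hV hr2
  have h2 := randomSubset_hoeffding (-r) ht hV hr2'
  linarith

/-! ### Passing to small subsets -/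

lemma sum_sum_erase {α : Type*} [DecidableEq α] (u : α → ℝ) (S : Finset α) :
    ∑ z ∈ S, ∑ x ∈ S.erase z, u x = (S.card - 1) * ∑ x ∈ S, u x := by
  rw [sum_congr rfl fun z hz => sum_erase_eq_sub hz, sum_sub_distrib, sum_const, nsmul_eq_mul]
  ring

lemma sum_sum_offDiag_erase {α : Type*} [DecidableEq α] (v : α × α → ℝ) (S : Finset α) :
    ∑ z ∈ S, ∑ p ∈ (S.erase z).offDiag, v p = (S.card - 2) * ∑ p ∈ S.offDiag, v p := by
  have h1 (z : α) : (S.erase z).offDiag = S.offDiag.filter fun p => z ≠ p.1 ∧ z ≠ p.2 := by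
    ext p
    simp only [mem_offDiag, mem_erase, mem_filter]
    tauto
  simp only [h1, sum_filter]
  rw [sum_comm, mul_sum]
  refine sum_congr rfl fun p hp => ?_
  obtain ⟨hp1, hp2, hp3⟩ := mem_offDiag.1 hp
  rw [← sum_filter, sum_const, nsmul_eq_mul]
  congr 1
  have h2 : S.filter (fun z => z ≠ p.1 ∧ z ≠ p.2) = (S.erase p.1).erase p.2 := by
    ext z
    simp only [mem_filter, mem_erase]
    tauto
  have h3 : p.2 ∈ S.erase p.1 := mem_erase.2 ⟨hp3.symm, hp2⟩
  have h4 := card_erase_add_one hp1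
  have h5 := card_erase_add_one h3
  rw [h2, ← h4, ← h5]
  push_cast
  ring

/-- Among the subsets of `S` of size `a`, some subset does at least as well as `S` for a functional
made of a normalised linear and a normalised off-diagonal quadratic term. Both normalised terms are
preserved on average when a single element is removed. -/
lemma exists_subset_card_eq_le {α : Type*} [DecidableEq α] (u : α → ℝ) (v : α × α → ℝ)
    {a : ℕ} (ha : 2 ≤ a) (S : Finset α) (hS : a ≤ S.card) :
    ∃ T ⊆ S, T.card = a ∧
      (∑ x ∈ S, u x) / S.card - (∑ p ∈ S.offDiag, v p) / (S.card * (S.card - 1)) ≤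
        (∑ x ∈ T, u x) / a - (∑ p ∈ T.offDiag, v p) / (a * (a - 1)) := by
  obtain ⟨k, hk⟩ : ∃ k, S.card = k := ⟨_, rfl⟩
  rw [hk] at hS
  induction k, hS using Nat.le_induction generalizing S with
  | base => exact ⟨S, subset_rfl, hk, by rw [hk]⟩
  | succ k hak ih =>
    have hk2 : (2 : ℝ) ≤ k := by exact_mod_cast ha.trans hak
    have hne : S.Nonempty := card_pos.1 (by omega)
    have hkS : (S.card : ℝ) = k + 1 := by rw [hk]; push_cast; rfl
    obtain ⟨z, hz, hle⟩ : ∃ z ∈ S,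
        (∑ x ∈ S, u x) / S.card - (∑ p ∈ S.offDiag, v p) / (S.card * (S.card - 1)) ≤
          (∑ x ∈ S.erase z, u x) / k - (∑ p ∈ (S.erase z).offDiag, v p) / (k * (k - 1)) := by
      refine exists_le_of_sum_le hne ?_
      rw [sum_const, nsmul_eq_mul, sum_sub_distrib, ← sum_div, ← sum_div, sum_sum_erase,
        sum_sum_offDiag_erase, hkS]
      have h1 : (k : ℝ) ≠ 0 := by linarith
      have h2 : (k : ℝ) - 1 ≠ 0 := by linarith
      have h3 : (k : ℝ) + 1 ≠ 0 := by linarith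
      apply le_of_eq
      have h4 : (k : ℝ) + 1 - 1 = k := by ring
      have h5 : (k : ℝ) + 1 - 2 = k - 1 := by ring
      rw [h4, h5]
      field_simp
    have hcard : (S.erase z).card = k := by rw [card_erase_of_mem hz, hk]; rfl
    obtain ⟨T, hT, hTa, hTle⟩ := ih _ hcard
    refine ⟨T, hT.trans (erase_subset _ _), hTa, hle.trans ?_⟩
    rwa [hcard] at hTle

/-- The number of solutions of `x + y = x' + y'` with `x ≠ x'` in `X` and `y ≠ y'` in `Y`. -/
def offDiagEnergy {G : Type*} [Add G] [DecidableEq G] (X Y : Finset G) : ℕ :=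
  #{p ∈ X.offDiag ×ˢ Y.offDiag | p.1.1 + p.2.1 = p.1.2 + p.2.2}

lemma addEnergy_eq_card_mul_add {G : Type*} [AddGroup G] [DecidableEq G] (X Y : Finset G) :
    E[X, Y] = X.card * Y.card + offDiagEnergy X Y := by
  have h : ((X ×ˢ X) ×ˢ Y ×ˢ Y).filter (fun p => p.1.1 + p.2.1 = p.1.2 + p.2.2) =
      (X.diag ×ˢ Y.diag) ∪
        (X.offDiag ×ˢ Y.offDiag).filter (fun p => p.1.1 + p.2.1 = p.1.2 + p.2.2) := by
    ext ⟨⟨x, x'⟩, y, y'⟩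
    simp only [mem_filter, mem_union, mem_product, mem_diag, mem_offDiag]
    constructor
    · rintro ⟨⟨⟨hx, hx'⟩, hy, hy'⟩, h⟩
      by_cases hxx : x = x'
      · subst hxx
        exact Or.inl ⟨⟨hx, rfl⟩, hy, add_left_cancel h⟩
      · refine Or.inr ⟨⟨⟨hx, hx', hxx⟩, hy, hy', fun hyy => hxx ?_⟩, h⟩
        subst hyy
        exact add_right_cancel h
    · rintro (⟨⟨hx, rfl⟩, hy, rfl⟩ | ⟨⟨⟨hx, hx', -⟩, hy, hy', -⟩, h⟩)
      · exact ⟨⟨⟨hx, hx⟩, hy, hy⟩, rfl⟩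
      · exact ⟨⟨⟨hx, hx'⟩, hy, hy'⟩, h⟩
  have hdisj : Disjoint (X.diag ×ˢ Y.diag)
      ((X.offDiag ×ˢ Y.offDiag).filter (fun p => p.1.1 + p.2.1 = p.1.2 + p.2.2)) := by
    rw [disjoint_left]
    rintro ⟨⟨x, x'⟩, y, y'⟩ h1 h2
    simp only [mem_filter, mem_product, mem_diag, mem_offDiag] at h1 h2
    exact h2.1.1.2.2 h1.1.2
  unfold Finset.addEnergy offDiagEnergy
  rw [h, card_union_of_disjoint hdisj, card_product, diag_card, diag_card]

lemma offDiagEnergy_le {G : Type*} [AddGroup G] [DecidableEq G] (X Y : Finset G) :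
    offDiagEnergy X Y ≤ X.card ^ 2 * Y.card := by
  have : #((X ×ˢ X) ×ˢ Y) = X.card ^ 2 * Y.card := by simp [sq]
  rw [← this]
  unfold offDiagEnergy
  refine card_le_card_of_injOn (fun p => (p.1, p.2.1)) ?_ ?_
  · rintro ⟨⟨x, x'⟩, y, y'⟩ h
    simp only [coe_filter, mem_product, mem_offDiag, Set.mem_ofPred_eq] at h
    simp [h.1.1.1, h.1.1.2.1, h.1.2.1]
  · rintro ⟨⟨x, x'⟩, y, y'⟩ h ⟨⟨z, z'⟩, t, t'⟩ h' heq
    simp only [coe_filter, mem_product, mem_offDiag, Set.mem_ofPred_eq] at h h'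
    simp only [Prod.mk.injEq] at heq
    obtain ⟨⟨rfl, rfl⟩, rfl⟩ := heq
    have := add_left_cancel (h.2.symm.trans h'.2)
    simp [this]

/-- Small samples inherit a large correlation: if `X`, `Y` correlate with `A` and have few
nontrivial additive coincidences, then there are subsets of prescribed sizes `a`, `b` which still
correlate with `A` and have essentially no more coincidences than the trivial ones. -/
lemma exists_subsets_of_le_abs_signSum {G : Type*} [AddGroup G] [DecidableEq G] (A : Set G)
    (X Y : Finset G) {ε : ℝ} (hε : 0 < ε) {a b : ℕ} (ha : 2 ≤ a) (hb : 2 ≤ b) (haX : a ≤ X.card)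
    (hbY : b ≤ Y.card) (hcor : ε * (X.card * Y.card) ≤ |signSum A X Y|)
    (hen : (offDiagEnergy X Y : ℝ) * (a * b) ≤ ε / 2 * (X.card * Y.card) ^ 2) :
    ∃ X' ⊆ X, ∃ Y' ⊆ Y, X'.card = a ∧ Y'.card = b ∧ ε / 2 * (a * b) ≤ |signSum A X' Y'| ∧
      offDiagEnergy X' Y' ≤ a * b := by
  -- the sign `σ` makes the correlation of `X` and `Y` positive
  obtain ⟨σ, hσ, hσ1⟩ : ∃ σ : ℝ, σ * signSum A X Y = |signSum A X Y| ∧ |σ| = 1 := by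
    rcases abs_choice (signSum A X Y) with h | h
    · exact ⟨1, by rw [h, one_mul], by simp⟩
    · exact ⟨-1, by rw [h]; ring, by simp⟩
  set e : (G × G) × (G × G) → ℝ := fun p => if p.1.1 + p.2.1 = p.1.2 + p.2.2 then 1 else 0 with he
  have hen1 (S T : Finset G) :
      (offDiagEnergy S T : ℝ) = ∑ p ∈ S.offDiag, ∑ q ∈ T.offDiag, e (p, q) := by
    rw [← sum_product', offDiagEnergy, card_filter]
    push_cast
    rfl
  have ha' : (2 : ℝ) ≤ a := by exact_mod_cast ha
  have hb' : (2 : ℝ) ≤ b := by exact_mod_cast hb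
  have haX' : (a : ℝ) ≤ X.card := by exact_mod_cast haX
  have hbY' : (b : ℝ) ≤ Y.card := by exact_mod_cast hbY
  set x : ℝ := (X.card : ℝ) with hx
  set y : ℝ := (Y.card : ℝ) with hy
  set α : ℝ := (a : ℝ) with hα
  set β : ℝ := (b : ℝ) with hβ
  have hx0 : 0 < x := by linarith
  have hy0 : 0 < y := by linarith
  have ha0 : 0 < α := by linarith
  have hb0 : 0 < β := by linarith
  have hx1 : 0 < x - 1 := by linarith
  have hy1 : 0 < y - 1 := by linarith
  have ha1 : 0 < α - 1 := by linarith
  have hb1 : 0 < β - 1 := by linarith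
  -- the weights are chosen so that the energy of `X'`, `Y'` has coefficient `1 / (a * b)` in the end
  obtain ⟨X', hX', hXa, h1⟩ := exists_subset_card_eq_le
    (fun s => σ * (∑ t ∈ Y, signFn A (s + t)) / y)
    (fun p => (∑ q ∈ Y.offDiag, e (p, q)) * ((α - 1) * (β - 1) / (y * (y - 1)))) ha X haX
  obtain ⟨Y', hY', hYb, h2⟩ := exists_subset_card_eq_le
    (fun t => σ * (∑ s ∈ X', signFn A (s + t)) / α)
    (fun q => (∑ p ∈ X'.offDiag, e (p, q)) * ((β - 1) / α)) hb Y hbY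
  rw [← hx, ← hα, ← sum_div, ← mul_sum, ← sum_mul, ← hen1] at h1
  rw [← sum_div, ← mul_sum, ← sum_mul, ← hen1] at h1
  have hcomm (T : Finset G) : ∑ t ∈ T, ∑ s ∈ X', signFn A (s + t) = signSum A X' T := sum_comm
  have hcommE (T : Finset G) :
      ∑ q ∈ T.offDiag, ∑ p ∈ X'.offDiag, e (p, q) = offDiagEnergy X' T := by rw [hen1, sum_comm]
  rw [← hy, ← hβ, ← sum_div, ← mul_sum, ← sum_mul, hcomm, hcommE, ← sum_div, ← mul_sum, ← sum_mul,
    hcomm, hcommE] at h2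
  change σ * signSum A X Y / y / x - _ ≤ σ * signSum A X' Y / y / α - _ at h1
  have hlink : σ * signSum A X' Y / y / α -
      (offDiagEnergy X' Y : ℝ) * ((α - 1) * (β - 1) / (y * (y - 1))) / (α * (α - 1)) =
      σ * signSum A X' Y / α / y -
      (offDiagEnergy X' Y : ℝ) * ((β - 1) / α) / (y * (y - 1)) := by
    field_simp
  have hstart : ε / 2 ≤ σ * signSum A X Y / y / x -
      (offDiagEnergy X Y : ℝ) * ((α - 1) * (β - 1) / (y * (y - 1))) / (x * (x - 1)) := by
    have h3 : ε ≤ σ * signSum A X Y / y / x := by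
      rw [hσ, div_div, le_div_iff₀ (by positivity)]
      linarith
    have h4 : (offDiagEnergy X Y : ℝ) * ((α - 1) * (β - 1) / (y * (y - 1))) / (x * (x - 1)) ≤
        ε / 2 := by
      have h5 : (α - 1) / (x - 1) ≤ α / x := by
        rw [div_le_div_iff₀ hx1 (by linarith)]
        nlinarith
      have h6 : (β - 1) / (y - 1) ≤ β / y := by
        rw [div_le_div_iff₀ hy1 (by linarith)]
        nlinarith
      have h7 : (α - 1) / (x - 1) * ((β - 1) / (y - 1)) ≤ α / x * (β / y) := by gcongr
      calc (offDiagEnergy X Y : ℝ) * ((α - 1) * (β - 1) / (y * (y - 1))) / (x * (x - 1))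
          = offDiagEnergy X Y / (x * y) * ((α - 1) / (x - 1) * ((β - 1) / (y - 1))) := by
            field_simp
        _ ≤ offDiagEnergy X Y / (x * y) * (α / x * (β / y)) := by gcongr
        _ = offDiagEnergy X Y * (α * β) / (x * y) ^ 2 := by field_simp
        _ ≤ ε / 2 := by
            rw [div_le_iff₀ (by positivity)]
            exact hen
    linarith
  have hend : ε / 2 ≤ (σ * signSum A X' Y' - offDiagEnergy X' Y') / (α * β) := by
    refine (hstart.trans (h1.trans (hlink.le.trans h2))).trans (le_of_eq ?_)
    field_simp
  rw [le_div_iff₀ (by positivity)] at hend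
  have hle : σ * signSum A X' Y' ≤ |signSum A X' Y'| := by
    refine (le_abs_self _).trans ?_
    rw [abs_mul, hσ1, one_mul]
  have hle2 := abs_signSum_le A X' Y'
  rw [hXa, hYb] at hle2
  have hpos : 0 ≤ ε / 2 * (α * β) := by positivity
  refine ⟨X', hX', Y', hY', hXa, hYb, ?_, ?_⟩
  · have : (0 : ℝ) ≤ offDiagEnergy X' Y' := by positivity
    linarith
  · have : (offDiagEnergy X' Y' : ℝ) ≤ a * b := by linarith
    exact_mod_cast this

/-! ### Energy of independent sets and the decomposition -/

/-- The induction step of the isoperimetric inequality below. The constant `3` comes from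
`3 * log 2 ≥ 2`. -/
lemma mul_log_add_mul_log_add_le {a b c : ℝ} (ha : 1 ≤ a) (hb : 1 ≤ b) (hca : c ≤ 2 * a)
    (hcb : c ≤ 2 * b) :
    c + 3 * (a * Real.log a) + 3 * (b * Real.log b) ≤ 3 * ((a + b) * Real.log (a + b)) := by
  wlog hab : a ≤ b generalizing a b
  · have := this hb ha hcb hca (le_of_not_ge hab)
    rw [add_comm b a] at this
    linarith
  have h2 := Real.log_two_gt_d9
  have h3 : Real.log a + Real.log 2 ≤ Real.log (a + b) := by
    rw [← Real.log_mul (by positivity) (by norm_num)]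
    exact Real.log_le_log (by positivity) (by linarith)
  have h4 : Real.log b ≤ Real.log (a + b) := Real.log_le_log (by positivity) (by linarith)
  nlinarith [mul_le_mul_of_nonneg_left h3 (by positivity : 0 ≤ a),
    mul_le_mul_of_nonneg_left h4 (by positivity : 0 ≤ b)]

/-- An edge-isoperimetric inequality of hypercube type: if the directions in `B` can be separated
by characters, then `Y` spans at most `O(|Y| log |Y|)` edges in these directions. The induction
splits `Y` along a character for which only one direction crosses. -/
lemma card_edges_le {V : Type*} [AddCommGroup V] [DecidableEq V] (B : Finset V)
    (hB : ∀ b ∈ B, ∃ φ : V →+ ZMod 2, φ b = 1 ∧ ∀ b' ∈ B, b' ≠ b → φ b' = 0) (Y : Finset V) :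
    (#{p ∈ Y ×ˢ B | p.1 + p.2 ∈ Y} : ℝ) ≤ 3 * (Y.card * Real.log Y.card) := by
  induction Y using Finset.strongInduction with
  | H Y ih =>
  rcases ((Y ×ˢ B).filter fun p => p.1 + p.2 ∈ Y).eq_empty_or_nonempty with h0 | ⟨⟨y, b⟩, hyb⟩
  · rw [h0, card_empty, Nat.cast_zero]
    have := Real.log_natCast_nonneg Y.card
    positivity
  · simp only [mem_filter, mem_product] at hyb
    obtain ⟨⟨hy, hb⟩, hybY⟩ := hyb
    obtain ⟨φ, hφb, hφ⟩ := hB b hb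
    have hz (t : ZMod 2) : t ≠ 0 ↔ t + 1 = 0 := by revert t; decide
    have hz' (t : ZMod 2) : t + 1 ≠ 0 ↔ t = 0 := by revert t; decide
    set Y₀ := Y.filter fun y => φ y = 0 with hY₀
    set Y₁ := Y.filter fun y => φ y ≠ 0 with hY₁
    have hcard : Y₀.card + Y₁.card = Y.card := card_filter_add_card_filter_not _
    have hne : Y₀.Nonempty ∧ Y₁.Nonempty := by
      by_cases h : φ y = 0
      · exact ⟨⟨y, by simp [hY₀, hy, h]⟩, ⟨y + b, by simp [hY₁, hybY, h, hφb]⟩⟩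
      · refine ⟨⟨y + b, ?_⟩, ⟨y, by simp [hY₁, hy, h]⟩⟩
        simp only [hY₀, mem_filter, map_add, hφb]
        exact ⟨hybY, (hz _).1 h⟩
    have h0Y : Y₀ ⊂ Y := by
      refine ⟨filter_subset _ _, fun h => ?_⟩
      have := card_le_card h
      have := hne.2.card_pos
      omega
    have h1Y : Y₁ ⊂ Y := by
      refine ⟨filter_subset _ _, fun h => ?_⟩
      have := card_le_card h
      have := hne.1.card_pos
      omega
    -- the edges in direction `b`, split by their starting point
    set C₀ := Y₀.filter fun y => y + b ∈ Y₁ with hC₀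
    set C₁ := Y₁.filter fun y => y + b ∈ Y₀ with hC₁
    have hC00 : C₀.card ≤ Y₀.card := card_filter_le _ _
    have hC11 : C₁.card ≤ Y₁.card := card_filter_le _ _
    have hC01 : C₀.card ≤ Y₁.card := card_le_card_of_injOn (· + b)
      (fun t ht => (mem_filter.1 (mem_coe.1 ht)).2) (fun _ _ _ _ h => add_right_cancel h)
    have hC10 : C₁.card ≤ Y₀.card := card_le_card_of_injOn (· + b)
      (fun t ht => (mem_filter.1 (mem_coe.1 ht)).2) (fun _ _ _ _ h => add_right_cancel h)
    have hsub : ((Y ×ˢ B).filter fun p => p.1 + p.2 ∈ Y) ⊆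
        ((((Y₀ ×ˢ B).filter fun p => p.1 + p.2 ∈ Y₀) ∪
          ((Y₁ ×ˢ B).filter fun p => p.1 + p.2 ∈ Y₁)) ∪
          (C₀ ×ˢ {b})) ∪ (C₁ ×ˢ {b}) := by
      rintro ⟨t, s⟩ hts
      simp only [mem_filter, mem_product] at hts
      obtain ⟨⟨ht, hs⟩, hts⟩ := hts
      simp only [mem_union, mem_filter, mem_product, mem_singleton, hC₀, hC₁, hY₀, hY₁, map_add,
        ht, hs, hts, true_and, and_true]
      by_cases hsb : s = b
      · subst hsb
        simp only [hφb, hz', and_true]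
        by_cases h : φ t = 0
        · simp [h, hts]
        · simp [h, (hz _).1 h, hts]
      · rw [hφ s hs hsb, add_zero]
        tauto
    have hle : #{p ∈ Y ×ˢ B | p.1 + p.2 ∈ Y} ≤ #{p ∈ Y₀ ×ˢ B | p.1 + p.2 ∈ Y₀} +
        #{p ∈ Y₁ ×ˢ B | p.1 + p.2 ∈ Y₁} + C₀.card + C₁.card := by
      refine (card_le_card hsub).trans ?_
      refine (card_union_le _ _).trans ?_
      rw [card_product C₁, card_singleton, mul_one]
      refine Nat.add_le_add_right ?_ _
      refine (card_union_le _ _).trans ?_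
      rw [card_product C₀, card_singleton, mul_one]
      exact Nat.add_le_add_right (card_union_le _ _) _
    have hle' : (#{p ∈ Y ×ˢ B | p.1 + p.2 ∈ Y} : ℝ) ≤ #{p ∈ Y₀ ×ˢ B | p.1 + p.2 ∈ Y₀} +
        #{p ∈ Y₁ ×ˢ B | p.1 + p.2 ∈ Y₁} + (C₀.card + C₁.card : ℕ) := by
      rw [add_assoc] at hle
      exact_mod_cast hle
    have hnum := mul_log_add_mul_log_add_le (a := Y₀.card) (b := Y₁.card)
      (c := (C₀.card + C₁.card : ℕ)) (by exact_mod_cast hne.1.card_pos)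
      (by exact_mod_cast hne.2.card_pos) (by exact_mod_cast (by omega)) (by exact_mod_cast (by omega))
    have i0 := ih Y₀ h0Y
    have i1 := ih Y₁ h1Y
    have hc : (Y.card : ℝ) = Y₀.card + Y₁.card := by exact_mod_cast hcard.symm
    rw [hc]
    linarith

lemma exists_character_of_linearIndepOn {V : Type*} [AddCommGroup V] [Module (ZMod 2) V]
    {s : Set V} (hs : LinearIndepOn (ZMod 2) id s) {b : V} (hb : b ∈ s) :
    ∃ φ : V →+ ZMod 2, φ b = 1 ∧ ∀ b' ∈ s, b' ≠ b → φ b' = 0 := by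
  have h1 : b ∉ Submodule.span (ZMod 2) (s \ {b}) := by
    simpa using (linearIndepOn_iff_notMem_span.1 hs) b hb
  obtain ⟨f, hf, hle⟩ := Submodule.exists_le_ker_of_notMem h1
  have hz (t : ZMod 2) : t ≠ 0 → t = 1 := by revert t; decide
  exact ⟨f.toAddMonoidHom, hz _ hf,
    fun b' hb' hne => hle (Submodule.subset_span ⟨hb', by simpa using hne⟩)⟩

/-- Independent sets have small energy with every set. For fixed `x`, the sums `x + x'` with
`x' ≠ x` are again separated by characters, so that the isoperimetric inequality bounds the number
of pairs in `Y` which differ by one of them. -/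
lemma addEnergy_le_of_linearIndepOn {V : Type*} [AddCommGroup V] [Module (ZMod 2) V]
    [DecidableEq V] (S Y : Finset V) (hS : LinearIndepOn (ZMod 2) id (S : Set V)) :
    (E[S, Y] : ℝ) ≤ S.card * (Y.card * (1 + 3 * Real.log Y.card)) := by
  have hself (v : V) : v + v = 0 := by
    have h2 : (2 : ZMod 2) = 0 := rfl
    rw [← two_smul (ZMod 2) v, h2, zero_smul]
  set B : V → Finset V := fun x => (S.erase x).image (x + ·) with hBdef
  have hB (x : V) (hx : x ∈ S) :
      ∀ b ∈ B x, ∃ φ : V →+ ZMod 2, φ b = 1 ∧ ∀ b' ∈ B x, b' ≠ b → φ b' = 0 := by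
    intro b hb
    simp only [hBdef, mem_image, mem_erase] at hb
    obtain ⟨x', ⟨hx'x, hx'⟩, rfl⟩ := hb
    obtain ⟨φ, h1, h2⟩ := exists_character_of_linearIndepOn hS (mem_coe.2 hx')
    refine ⟨φ, by rw [map_add, h1, h2 x hx hx'x.symm, zero_add], fun b' hb' hne => ?_⟩
    simp only [hBdef, mem_image, mem_erase] at hb'
    obtain ⟨x'', ⟨hx''x, hx''⟩, rfl⟩ := hb'
    rw [map_add, h2 x hx hx'x.symm, h2 x'' hx'' (fun h => hne (by rw [h])), zero_add]
  have hcard : offDiagEnergy S Y ≤ ∑ x ∈ S, #{p ∈ Y ×ˢ B x | p.1 + p.2 ∈ Y} := by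
    rw [← card_sigma]
    unfold offDiagEnergy
    refine card_le_card_of_injOn (fun p => ⟨p.1.1, p.2.1, p.1.1 + p.1.2⟩) ?_ ?_
    · rintro ⟨⟨x, x'⟩, y, y'⟩ h
      simp only [coe_filter, mem_product, mem_offDiag, Set.mem_ofPred_eq] at h
      obtain ⟨⟨⟨hx, hx', hxx⟩, hy, hy', -⟩, h⟩ := h
      have hyy : y + (x + x') = y' := by
        calc y + (x + x') = (x + y) + x' := by abel
          _ = (x' + x') + y' := by rw [h]; abel
          _ = y' := by rw [hself, zero_add]
      simp only [coe_sigma, Set.mem_sigma_iff, mem_coe, mem_filter, mem_product, hBdef, mem_image,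
        mem_erase]
      exact ⟨hx, ⟨hy, x', ⟨hxx.symm, hx'⟩, rfl⟩, by rwa [hyy]⟩
    · rintro ⟨⟨x, x'⟩, y, y'⟩ h ⟨⟨z, z'⟩, t, t'⟩ h' heq
      simp only [coe_filter, mem_product, mem_offDiag, Set.mem_ofPred_eq] at h h'
      simp only [Sigma.mk.injEq, heq_eq_eq, Prod.mk.injEq] at heq
      obtain ⟨rfl, rfl, h3⟩ := heq
      obtain rfl := add_left_cancel h3
      have := add_left_cancel (h.2.symm.trans h'.2)
      simp [this]
  have h1 : (offDiagEnergy S Y : ℝ) ≤ S.card * (3 * (Y.card * Real.log Y.card)) := by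
    calc (offDiagEnergy S Y : ℝ) ≤ ∑ x ∈ S, (#{p ∈ Y ×ˢ B x | p.1 + p.2 ∈ Y} : ℝ) := by
          exact_mod_cast hcard
      _ ≤ ∑ x ∈ S, 3 * (Y.card * Real.log Y.card) :=
          sum_le_sum fun x hx => card_edges_le (B x) (hB x hx) Y
      _ = _ := by rw [sum_const, nsmul_eq_mul]
  rw [addEnergy_eq_card_mul_add]
  push_cast
  linarith

/-- The square root of the energy is subadditive in the first set, in the scaled form in which
the decomposition below uses it. -/
lemma addEnergy_union_le {V : Type*} [AddCommGroup V] [Fintype V] [DecidableEq V]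
    {S T Y : Finset V} (hST : Disjoint S T) {K : ℝ} (hS : (E[S, Y] : ℝ) ≤ K * S.card ^ 2)
    (hT : (E[T, Y] : ℝ) ≤ K * T.card ^ 2) : (E[S ∪ T, Y] : ℝ) ≤ K * (S ∪ T).card ^ 2 := by
  rcases S.eq_empty_or_nonempty with rfl | hS0
  · simpa using hT
  rcases T.eq_empty_or_nonempty with rfl | hT0
  · simpa using hS
  have hs : (0 : ℝ) < S.card := by exact_mod_cast hS0.card_pos
  have ht : (0 : ℝ) < T.card := by exact_mod_cast hT0.card_pos
  have hsq (S : Finset V) :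
      (E[S, Y] : ℝ) = ∑ g, (#{p ∈ S ×ˢ Y | p.1 + p.2 = g} : ℝ) ^ 2 := by
    rw [addEnergy_eq_sum_sq]
    push_cast
    rfl
  rw [hsq] at hS hT ⊢
  have hr (g : V) : (#{p ∈ (S ∪ T) ×ˢ Y | p.1 + p.2 = g} : ℝ) =
      #{p ∈ S ×ˢ Y | p.1 + p.2 = g} + #{p ∈ T ×ˢ Y | p.1 + p.2 = g} := by
    rw [union_product, filter_union, card_union_of_disjoint, Nat.cast_add]
    exact disjoint_filter_filter (disjoint_product.2 (Or.inl hST))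
  rw [card_union_of_disjoint hST, Nat.cast_add]
  set s : ℝ := (S.card : ℝ)
  set t : ℝ := (T.card : ℝ)
  have hpt (g : V) : (#{p ∈ (S ∪ T) ×ˢ Y | p.1 + p.2 = g} : ℝ) ^ 2 ≤
      (s + t) / s * (#{p ∈ S ×ˢ Y | p.1 + p.2 = g} : ℝ) ^ 2 +
        (s + t) / t * (#{p ∈ T ×ˢ Y | p.1 + p.2 = g} : ℝ) ^ 2 := by
    rw [hr]
    set p : ℝ := (#{p ∈ S ×ˢ Y | p.1 + p.2 = g} : ℝ)
    set q : ℝ := (#{p ∈ T ×ˢ Y | p.1 + p.2 = g} : ℝ)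
    have : (s + t) / s * p ^ 2 + (s + t) / t * q ^ 2 - (p + q) ^ 2 =
        (t * p - s * q) ^ 2 / (s * t) := by
      field_simp
      ring
    have : 0 ≤ (t * p - s * q) ^ 2 / (s * t) := by positivity
    linarith
  refine (sum_le_sum fun g _ => hpt g).trans ?_
  rw [sum_add_distrib, ← mul_sum, ← mul_sum]
  calc _ ≤ (s + t) / s * (K * s ^ 2) + (s + t) / t * (K * t ^ 2) := by gcongr
    _ = K * (s + t) ^ 2 := by field_simp

/-- Every set is the union of a set with the energy bound of independent sets of size `d` and a
set of rank at most `d`: independent subsets of size `d` are removed as long as there are any. -/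
lemma exists_decomposition {V : Type*} [AddCommGroup V] [Module (ZMod 2) V] [Fintype V]
    [DecidableEq V] {d : ℕ} (hd : 0 < d) (X Y : Finset V) :
    ∃ S R : Finset V, Disjoint S R ∧ S ∪ R = X ∧
      (E[S, Y] : ℝ) ≤ Y.card * (1 + 3 * Real.log Y.card) / d * S.card ^ 2 ∧
      ∃ D : Finset V, D.card ≤ d ∧ (R : Set V) ⊆ Submodule.span (ZMod 2) (D : Set V) := by
  induction X using Finset.strongInduction with
  | H X ih =>
  obtain ⟨b, hbX, hspan, hind⟩ := exists_linearIndependent (ZMod 2) (X : Set V)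
  lift b to Finset V using (Set.toFinite b)
  by_cases hbd : b.card ≤ d
  · refine ⟨∅, X, by simp, by simp, by simp, b, hbd, ?_⟩
    rw [hspan]
    exact Submodule.subset_span
  · obtain ⟨c, hcb, hc⟩ := exists_subset_card_eq (le_of_not_ge hbd)
    have hcX : c ⊆ X := hcb.trans (by exact_mod_cast hbX)
    have hcind : LinearIndepOn (ZMod 2) id (c : Set V) :=
      LinearIndepOn.mono (show LinearIndepOn (ZMod 2) id (b : Set V) from hind)
        (by exact_mod_cast hcb)
    have hcne : c.Nonempty := card_pos.1 (hc ▸ hd)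
    obtain ⟨S, R, hSR, hU, hE, hD⟩ := ih (X \ c) (sdiff_ssubset hcX hcne)
    have hSc : Disjoint S c :=
      disjoint_of_subset_left (subset_union_left.trans hU.subset) sdiff_disjoint
    have hRc : Disjoint R c :=
      disjoint_of_subset_left (subset_union_right.trans hU.subset) sdiff_disjoint
    refine ⟨S ∪ c, R, disjoint_union_left.2 ⟨hSR, hRc.symm⟩, ?_, ?_, hD⟩
    · rw [union_right_comm, hU, sdiff_union_of_subset hcX]
    · refine addEnergy_union_le hSc hE ?_
      refine (addEnergy_le_of_linearIndepOn c Y hcind).trans (le_of_eq ?_)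
      rw [hc]
      have : (d : ℝ) ≠ 0 := by exact_mod_cast hd.ne'
      field_simp

/-! ### The union bound -/

/-- The union bound over all pairs of sets from two families which have few nontrivial additive
coincidences: correlation with a random set is exponentially unlikely in `a * b`. -/
lemma randomSubset_exists_abs_signSum_le {G : Type*} [AddGroup G] [Fintype G] [DecidableEq G]
    (𝒳 𝒴 : Finset (Finset G)) {a b : ℕ} (ha : 0 < a) (hb : 0 < b)
    (h𝒳 : ∀ X ∈ 𝒳, X.card = a) (h𝒴 : ∀ Y ∈ 𝒴, Y.card = b) {ε : ℝ} (hε : 0 < ε) :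
    (randomSubset G).real {A | ∃ X ∈ 𝒳, ∃ Y ∈ 𝒴, ε / 2 * (a * b) ≤ |signSum A X Y| ∧
      offDiagEnergy X Y ≤ a * b} ≤
      𝒳.card * 𝒴.card * (2 * Real.exp (-(ε ^ 2 * (a * b) / 16))) := by
  have ha' : (0 : ℝ) < a := by exact_mod_cast ha
  have hb' : (0 : ℝ) < b := by exact_mod_cast hb
  have hsub : {A | ∃ X ∈ 𝒳, ∃ Y ∈ 𝒴, ε / 2 * (a * b) ≤ |signSum A X Y| ∧
      offDiagEnergy X Y ≤ a * b} ⊆ ⋃ p ∈ 𝒳 ×ˢ 𝒴, {A | ε / 2 * (a * b) ≤ |signSum A p.1 p.2| ∧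
      offDiagEnergy p.1 p.2 ≤ a * b} := by
    rintro A ⟨X, hX, Y, hY, h⟩
    simp only [Set.mem_iUnion]
    exact ⟨(X, Y), mem_product.2 ⟨hX, hY⟩, h⟩
  refine (MeasureTheory.measureReal_mono hsub (MeasureTheory.measure_ne_top _ _)).trans ?_
  refine (MeasureTheory.measureReal_biUnion_finset_le _ _).trans ?_
  calc _ ≤ ∑ p ∈ 𝒳 ×ˢ 𝒴, 2 * Real.exp (-(ε ^ 2 * (a * b) / 16)) := ?_
    _ = _ := by rw [sum_const, card_product, nsmul_eq_mul, Nat.cast_mul]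
  refine sum_le_sum fun p hp => ?_
  obtain ⟨hX, hY⟩ := mem_product.1 hp
  by_cases h : offDiagEnergy p.1 p.2 ≤ a * b
  · have hE : (E[p.1, p.2] : ℝ) ≤ 2 * (a * b) := by
      rw [addEnergy_eq_card_mul_add, h𝒳 _ hX, h𝒴 _ hY]
      have h' : (offDiagEnergy p.1 p.2 : ℝ) ≤ a * b := by exact_mod_cast h
      push_cast
      linarith
    have := randomSubset_abs_signSum_le p.1 p.2 (t := ε / 2 * (a * b)) (by positivity)
      (by positivity) hE
    refine (MeasureTheory.measureReal_mono fun A hA => hA.1).trans (this.trans (le_of_eq ?_))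
    congr 3
    field_simp
    norm_num
  · simp only [h, and_false, Set.ofPred_false, MeasureTheory.measureReal_empty]
    positivity

/-- The sets of size `a` contained in a subspace spanned by `d` elements. -/
def lowRankFamily (V : Type*) [AddCommGroup V] [Module (ZMod 2) V] [Fintype V] [DecidableEq V]
    (d a : ℕ) : Finset (Finset V) :=
  univ.biUnion fun v : Fin d → V =>
    powersetCard a (univ.image fun c : Fin d → ZMod 2 => Fintype.linearCombination (ZMod 2) v c)

lemma card_of_mem_lowRankFamily {V : Type*} [AddCommGroup V] [Module (ZMod 2) V] [Fintype V]
    [DecidableEq V] {d a : ℕ} {Z : Finset V} (hZ : Z ∈ lowRankFamily V d a) : Z.card = a := by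
  simp only [lowRankFamily, mem_biUnion, mem_powersetCard] at hZ
  obtain ⟨-, -, -, h⟩ := hZ
  exact h

lemma card_lowRankFamily_le (V : Type*) [AddCommGroup V] [Module (ZMod 2) V] [Fintype V]
    [DecidableEq V] (d a : ℕ) :
    (lowRankFamily V d a).card ≤ Fintype.card V ^ d * (2 ^ d) ^ a := by
  have h := card_biUnion_le_card_mul (univ : Finset (Fin d → V))
    (fun v => powersetCard a
      (univ.image fun c : Fin d → ZMod 2 => Fintype.linearCombination (ZMod 2) v c))
    ((2 ^ d) ^ a) fun v _ => by
      rw [card_powersetCard]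
      refine (Nat.choose_le_pow _ _).trans (Nat.pow_le_pow_left ?_ _)
      refine card_image_le.trans ?_
      simp [ZMod.card]
  refine h.trans ?_
  simp

lemma mem_lowRankFamily {V : Type*} [AddCommGroup V] [Module (ZMod 2) V] [Fintype V]
    [DecidableEq V] {d a : ℕ} {Z D : Finset V} (hZ : Z.card = a) (hD : D.card ≤ d)
    (hZD : (Z : Set V) ⊆ Submodule.span (ZMod 2) (D : Set V)) : Z ∈ lowRankFamily V d a := by
  obtain ⟨g⟩ : Nonempty (D ↪ Fin d) :=
    Function.Embedding.nonempty_of_card_le (by simpa using hD)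
  set v : Fin d → V := Function.extend g (fun x : D => (x : V)) 0 with hv
  have hsub : (D : Set V) ⊆ Set.range v := by
    intro x hx
    exact ⟨g ⟨x, hx⟩, by rw [hv, g.injective.extend_apply]⟩
  simp only [lowRankFamily, mem_biUnion, mem_powersetCard, mem_univ, true_and]
  refine ⟨v, fun z hz => ?_, hZ⟩
  have h := Submodule.span_mono hsub (hZD (mem_coe.2 hz))
  rw [← Fintype.range_linearCombination] at h
  obtain ⟨c, hc⟩ := h
  exact mem_image.2 ⟨c, mem_univ _, hc⟩

/-- A correlation between `A` and large sets `X`, `Y` is witnessed by small sets with few nontrivial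
additive coincidences: either by arbitrary sets of size `a`, or by a set of size `a` of rank at most
`d` together with a set of the possibly much smaller size `b`. -/
lemma exists_witness_of_le_abs_signSum {V : Type*} [AddCommGroup V] [Module (ZMod 2) V] [Fintype V]
    [DecidableEq V] (A : Set V) (X Y : Finset V) {ε : ℝ} (hε : 0 < ε) {a b d : ℕ} (hb : 2 ≤ b)
    (hba : b ≤ a) (hd : 0 < d) (haX : (a : ℝ) ≤ ε * X.card) (haY : a ≤ Y.card)
    (hlog : (a : ℝ) ^ 2 * (1 + 3 * Real.log Y.card) ≤ ε / 2 * (d * Y.card))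
    (hab : (a * b : ℝ) ≤ ε / 2 * Y.card)
    (hcor : 2 * ε * (X.card * Y.card) ≤ |signSum A X Y|) :
    (∃ X' ∈ powersetCard a univ, ∃ Y' ∈ powersetCard a univ,
      ε / 2 * (a * a) ≤ |signSum A X' Y'| ∧ offDiagEnergy X' Y' ≤ a * a) ∨
    (∃ X' ∈ lowRankFamily V d a, ∃ Y' ∈ powersetCard b univ,
      ε / 2 * (a * b) ≤ |signSum A X' Y'| ∧ offDiagEnergy X' Y' ≤ a * b) := by
  obtain ⟨S, R, hSR, hU, hE, D, hD, hRD⟩ := exists_decomposition hd X Y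
  have hY0 : (0 : ℝ) < Y.card := by
    have : 0 < Y.card := by omega
    exact_mod_cast this
  have hd' : (0 : ℝ) < d := by exact_mod_cast hd
  have hsum : signSum A X Y = signSum A S Y + signSum A R Y := by
    unfold signSum
    rw [← hU, sum_union hSR]
  -- a part of `X` carrying half of the correlation is large and correlates with `A`
  have hpart (Z : Finset V) (hZ : Z ⊆ X) (h : ε * (X.card * Y.card) ≤ |signSum A Z Y|) :
      a ≤ Z.card ∧ ε * (Z.card * Y.card) ≤ |signSum A Z Y| := by
    constructor
    · have h1 := h.trans (abs_signSum_le A Z Y)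
      have h2 : ε * X.card ≤ Z.card := by
        refine le_of_mul_le_mul_right ?_ hY0
        linarith
      exact_mod_cast haX.trans h2
    · refine le_trans ?_ h
      gcongr
  have hor : ε * (X.card * Y.card) ≤ |signSum A S Y| ∨ ε * (X.card * Y.card) ≤ |signSum A R Y| := by
    by_contra! h
    have := abs_add_le (signSum A S Y) (signSum A R Y)
    rw [← hsum] at this
    linarith
  rcases hor with h | h
  · left
    obtain ⟨haS, hS⟩ := hpart S (subset_union_left.trans hU.subset) h
    obtain ⟨X', -, Y', -, hX', hY', h1, h2⟩ := exists_subsets_of_le_abs_signSum A S Y hε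
      (hb.trans hba) (hb.trans hba) haS haY hS (by
        have hle : (offDiagEnergy S Y : ℝ) ≤ E[S, Y] := by
          rw [addEnergy_eq_card_mul_add]
          exact_mod_cast Nat.le_add_left _ _
        calc (offDiagEnergy S Y : ℝ) * (a * a)
            ≤ Y.card * (1 + 3 * Real.log Y.card) / d * S.card ^ 2 * (a * a) := by
              gcongr
              exact hle.trans hE
          _ = Y.card * S.card ^ 2 / d * ((a : ℝ) ^ 2 * (1 + 3 * Real.log Y.card)) := by ring
          _ ≤ Y.card * S.card ^ 2 / d * (ε / 2 * (d * Y.card)) := by gcongr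
          _ = ε / 2 * (S.card * Y.card) ^ 2 := by field_simp)
    exact ⟨X', mem_powersetCard.2 ⟨subset_univ _, hX'⟩, Y',
      mem_powersetCard.2 ⟨subset_univ _, hY'⟩, h1, h2⟩
  · right
    obtain ⟨haR, hR⟩ := hpart R (subset_union_right.trans hU.subset) h
    obtain ⟨X', hXR, Y', -, hX', hY', h1, h2⟩ := exists_subsets_of_le_abs_signSum A R Y hε
      (hb.trans hba) hb haR (hba.trans haY) hR (by
        have hle : (offDiagEnergy R Y : ℝ) ≤ R.card ^ 2 * Y.card := by
          exact_mod_cast offDiagEnergy_le R Y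
        calc (offDiagEnergy R Y : ℝ) * (a * b)
            ≤ R.card ^ 2 * Y.card * (ε / 2 * Y.card) := by gcongr
          _ = ε / 2 * (R.card * Y.card) ^ 2 := by ring)
    exact ⟨X', mem_lowRankFamily hX' hD ((coe_subset.2 hXR).trans hRD), Y',
      mem_powersetCard.2 ⟨subset_univ _, hY'⟩, h1, h2⟩

lemma card_powersetCard_univ_le_exp {G : Type*} [Fintype G] {ℓ : ℕ}
    (hℓ : (Fintype.card G : ℝ) ≤ Real.exp ℓ) (a : ℕ) :
    ((powersetCard a (univ : Finset G)).card : ℝ) ≤ Real.exp (ℓ * a) := by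
  have h : ((powersetCard a (univ : Finset G)).card : ℝ) ≤ (Fintype.card G : ℝ) ^ a := by
    rw [card_powersetCard, card_univ]
    exact_mod_cast Nat.choose_le_pow _ _
  refine h.trans ?_
  rw [mul_comm, Real.exp_nat_mul]
  gcongr

lemma card_lowRankFamily_le_exp {V : Type*} [AddCommGroup V] [Module (ZMod 2) V] [Fintype V]
    [DecidableEq V] {ℓ : ℕ} (hℓ : (Fintype.card V : ℝ) ≤ Real.exp ℓ) (d a : ℕ) :
    ((lowRankFamily V d a).card : ℝ) ≤ Real.exp (ℓ * d + d * a) := by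
  have h : ((lowRankFamily V d a).card : ℝ) ≤ (Fintype.card V : ℝ) ^ d * 2 ^ (d * a) := by
    rw [pow_mul]
    exact_mod_cast card_lowRankFamily_le V d a
  refine h.trans ?_
  have h2 : (2 : ℝ) ≤ Real.exp 1 := by
    have := Real.add_one_le_exp (1 : ℝ)
    linarith
  rw [Real.exp_add]
  have h3 : Real.exp ((ℓ : ℝ) * d) = Real.exp ℓ ^ d := by rw [mul_comm, Real.exp_nat_mul]
  have h4 : Real.exp ((d : ℝ) * a) = Real.exp 1 ^ (d * a) := by
    rw [← Real.exp_nat_mul, mul_one, Nat.cast_mul]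
  rw [h3, h4]
  gcongr

/-- With sizes `a = C * ℓ` and `b = C * d`, where `ℓ ≥ log |V|` and `C ≫ ε⁻²`, the gain
`ε ^ 2 * a * b / 16` in Hoeffding's inequality exceeds the entropy `ℓ * d + d * a + ℓ * b` of the low
rank witnesses, and likewise for the arbitrary witnesses. -/
lemma randomSubset_correlated_le {V : Type*} [AddCommGroup V] [Module (ZMod 2) V] [Fintype V]
    [DecidableEq V] {ε : ℝ} (hε : 0 < ε) {C ℓ d : ℕ} (hC : 192 ≤ ε ^ 2 * C) (hC2 : 2 ≤ C)
    (hd : 0 < d) (hdℓ : d ≤ ℓ) (hℓ : (Fintype.card V : ℝ) ≤ Real.exp ℓ) (P : ℕ → Prop)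
    (hP : ∀ k, P k → ((C * ℓ : ℕ) : ℝ) ≤ ε * k ∧ C * ℓ ≤ k ∧
      ((C * ℓ : ℕ) : ℝ) ^ 2 * (1 + 3 * Real.log k) ≤ ε / 2 * (d * k) ∧
      ((C * ℓ : ℕ) * (C * d : ℕ) : ℝ) ≤ ε / 2 * k) :
    (randomSubset V).real {A | ∃ X Y : Finset V, P X.card ∧ P Y.card ∧
      2 * ε * (X.card * Y.card) ≤ |signSum A X Y|} ≤ 4 * Real.exp (-(2 * ℓ)) := by
  set a := C * ℓ with ha
  set b := C * d with hb
  have hba : b ≤ a := Nat.mul_le_mul_left _ hdℓ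
  have hb2 : 2 ≤ b := hC2.trans (Nat.le_mul_of_pos_right _ hd)
  have hdb : d ≤ b := Nat.le_mul_of_pos_left _ (by omega)
  have hsub : {A | ∃ X Y : Finset V, P X.card ∧ P Y.card ∧
      2 * ε * (X.card * Y.card) ≤ |signSum A X Y|} ⊆
      {A | ∃ X' ∈ powersetCard a (univ : Finset V), ∃ Y' ∈ powersetCard a (univ : Finset V),
        ε / 2 * (a * a) ≤ |signSum A X' Y'| ∧ offDiagEnergy X' Y' ≤ a * a} ∪
      {A | ∃ X' ∈ lowRankFamily V d a, ∃ Y' ∈ powersetCard b (univ : Finset V),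
        ε / 2 * (a * b) ≤ |signSum A X' Y'| ∧ offDiagEnergy X' Y' ≤ a * b} := by
    rintro A ⟨X, Y, hX, hY, h⟩
    obtain ⟨hX1, -⟩ := hP _ hX
    obtain ⟨-, hY1, hY2, hY3⟩ := hP _ hY
    exact exists_witness_of_le_abs_signSum A X Y hε hb2 hba hd hX1 hY1 hY2 hY3 h
  refine (MeasureTheory.measureReal_mono hsub).trans ?_
  refine (MeasureTheory.measureReal_union_le _ _).trans ?_
  have h1 := randomSubset_exists_abs_signSum_le (powersetCard a (univ : Finset V))
    (powersetCard a (univ : Finset V)) (a := a) (b := a) (by omega) (by omega)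
    (fun X hX => (mem_powersetCard.1 hX).2) (fun X hX => (mem_powersetCard.1 hX).2) hε
  have h2 := randomSubset_exists_abs_signSum_le (lowRankFamily V d a)
    (powersetCard b (univ : Finset V)) (a := a) (b := b) (by omega) (by omega)
    (fun X hX => card_of_mem_lowRankFamily hX) (fun X hX => (mem_powersetCard.1 hX).2) hε
  have hb2' : (2 : ℝ) ≤ b := by exact_mod_cast hb2
  have hba' : (b : ℝ) ≤ a := by exact_mod_cast hba
  have hdb' : (d : ℝ) ≤ b := by exact_mod_cast hdb
  have ha' : (a : ℝ) = C * ℓ := by rw [ha]; push_cast; rfl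
  have hb' : (b : ℝ) = C * d := by rw [hb]; push_cast; rfl
  have hℓ0 : (0 : ℝ) ≤ ℓ := by positivity
  have hg1 : 2 * (ℓ : ℝ) * a + 2 * ℓ ≤ ε ^ 2 * (a * a) / 16 := by
    have h3 : ε ^ 2 * (a * a) / 16 = ε ^ 2 * C * (ℓ * a) / 16 := by rw [ha']; ring
    have h4 : 192 * (ℓ * a : ℝ) ≤ ε ^ 2 * C * (ℓ * a) := by gcongr
    have h5 : (ℓ : ℝ) * 2 ≤ ℓ * a := by gcongr; linarith
    rw [h3]
    linarith
  have hg2 : (ℓ : ℝ) * d + d * a + ℓ * b + 2 * ℓ ≤ ε ^ 2 * (a * b) / 16 := by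
    have h3 : ε ^ 2 * (a * b) / 16 = ε ^ 2 * C * (ℓ * b) / 16 := by rw [ha']; ring
    have h3' : ε ^ 2 * (a * b) / 16 = ε ^ 2 * C * (d * a) / 16 := by rw [hb']; ring
    have h4 : 192 * (ℓ * b : ℝ) ≤ ε ^ 2 * C * (ℓ * b) := by gcongr
    have h4' : 192 * (d * a : ℝ) ≤ ε ^ 2 * C * (d * a) := by gcongr
    have h5 : (ℓ : ℝ) * 2 ≤ ℓ * b := by gcongr
    have h6 : (ℓ : ℝ) * d ≤ ℓ * b := by gcongr
    have h7 : (0 : ℝ) ≤ d * a := by positivity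
    linarith
  have h3 : ((powersetCard a (univ : Finset V)).card : ℝ) * (powersetCard a (univ : Finset V)).card *
      (2 * Real.exp (-(ε ^ 2 * (a * a) / 16))) ≤ 2 * Real.exp (-(2 * ℓ)) := by
    have hc := card_powersetCard_univ_le_exp hℓ a
    calc _ ≤ Real.exp (ℓ * a) * Real.exp (ℓ * a) * (2 * Real.exp (-(ε ^ 2 * (a * a) / 16))) := by
          gcongr
      _ = 2 * Real.exp (ℓ * a + ℓ * a + -(ε ^ 2 * (a * a) / 16)) := by
          rw [Real.exp_add, Real.exp_add]; ring
      _ ≤ _ := by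
          gcongr
          linarith
  have h4 : ((lowRankFamily V d a).card : ℝ) * (powersetCard b (univ : Finset V)).card *
      (2 * Real.exp (-(ε ^ 2 * (a * b) / 16))) ≤ 2 * Real.exp (-(2 * ℓ)) := by
    have hc := card_powersetCard_univ_le_exp hℓ b
    have hc' := card_lowRankFamily_le_exp hℓ d a
    calc _ ≤ Real.exp (ℓ * d + d * a) * Real.exp (ℓ * b) *
          (2 * Real.exp (-(ε ^ 2 * (a * b) / 16))) := by
          gcongr
      _ = 2 * Real.exp (ℓ * d + d * a + ℓ * b + -(ε ^ 2 * (a * b) / 16)) := by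
          rw [Real.exp_add (ℓ * d + d * a + ℓ * b : ℝ), Real.exp_add (ℓ * d + d * a : ℝ)]; ring
      _ ≤ _ := by
          gcongr
          linarith
  linarith

/-! ### The size threshold and the choice of the error -/

/-- The size threshold dominates `M * (log N) ^ (3 / 2) * log y` for every constant `M`; if
`y = t * (log N) ^ (3 / 2)`, then `log y` splits into `log t`, which is small compared with `t`, and
a multiple of `log log N`, which is a factor of the threshold. -/
lemma eventually_mul_log_le {w : ℕ → ℝ} (hw : Filter.Tendsto w Filter.atTop Filter.atTop) {M : ℝ}
    (hM : 1 ≤ M) : ∀ᶠ N : ℕ in Filter.atTop, ∀ y : ℝ,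
      w N * Real.log (Real.log N) * Real.log N ^ (3 / 2 : ℝ) ≤ y →
        1 ≤ y ∧ M * Real.log N ^ (3 / 2 : ℝ) * (1 + 3 * Real.log y) ≤ y := by
  have hlogN : Filter.Tendsto (fun N : ℕ => Real.log N) Filter.atTop Filter.atTop :=
    Real.tendsto_log_atTop.comp tendsto_natCast_atTop_atTop
  have hloglogN : Filter.Tendsto (fun N : ℕ => Real.log (Real.log N)) Filter.atTop Filter.atTop :=
    Real.tendsto_log_atTop.comp hlogN
  obtain ⟨T, hT⟩ := Filter.eventually_atTop.1
    (Real.isLittleO_log_id_atTop.def (show 0 < 1 / (6 * M) by positivity))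
  filter_upwards [hlogN.eventually_ge_atTop 1, hloglogN.eventually_ge_atTop 1,
    hw.eventually_ge_atTop (max T (11 * M))] with N hL hlam hwN y hy
  set L := Real.log N
  set lam := Real.log L
  set P := L ^ (3 / 2 : ℝ) with hPdef
  have hP : 1 ≤ P := Real.one_le_rpow hL (by norm_num)
  have hlogP : Real.log P = 3 / 2 * lam := Real.log_rpow (by linarith) _
  have hwT : T ≤ w N := (le_max_left _ _).trans hwN
  have hwM : 11 * M ≤ w N := (le_max_right _ _).trans hwN
  set t := y / P with ht
  have hyt : y = t * P := by rw [ht]; field_simp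
  have hwt : w N * lam ≤ t := by rwa [ht, le_div_iff₀ (by linarith)]
  have hwlam : w N ≤ w N * lam := le_mul_of_one_le_right (by linarith) hlam
  have htT : T ≤ t := by linarith
  have ht11 : 11 * M * lam ≤ t := le_trans (by gcongr) hwt
  have ht1 : 1 ≤ t := by linarith
  have hlogt : Real.log t ≤ 1 / (6 * M) * t := by
    have := hT t htT
    rw [id, Real.norm_eq_abs, Real.norm_eq_abs, abs_of_nonneg (Real.log_nonneg ht1),
      abs_of_pos (by linarith)] at this
    exact this
  have hlogy : Real.log y = Real.log t + 3 / 2 * lam := by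
    rw [hyt, Real.log_mul (by positivity) (by positivity), hlogP]
  refine ⟨by rw [hyt]; nlinarith, ?_⟩
  have h1 : M * (3 * Real.log t) ≤ t / 2 := by
    calc M * (3 * Real.log t) ≤ M * (3 * (1 / (6 * M) * t)) := by gcongr
      _ = t / 2 := by field_simp; norm_num
  have h2 : M * (1 + 9 / 2 * lam) ≤ t / 2 := by
    have : M * 1 ≤ M * lam := by gcongr
    linarith
  calc M * P * (1 + 3 * Real.log y)
      = P * (M * (3 * Real.log t) + M * (1 + 9 / 2 * lam)) := by rw [hlogy]; ring
    _ ≤ P * (t / 2 + t / 2) := by gcongr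
    _ = y := by rw [hyt]; ring

/-- In every group of exponent `2` and order `N`, with probability at least `1 - 1 / N` the edge
density between sets above the size threshold deviates from `1 / 2` by at most `ε`. -/
def RegularWithError.{u} (w : ℕ → ℝ) (ε : ℝ) (N : ℕ) : Prop :=
  ∀ (G : Type u) [AddGroup G] [Finite G],
    AddMonoid.exponent G = 2 → Nat.card G = N →
      1 - 1 / (N : ℝ) ≤ (randomSubset G).real
        {A : Set G | ∀ X Y : Finset G,
          w N * Real.log (Real.log N) * Real.log N ^ (3 / 2 : ℝ) ≤ (X.card : ℝ) →
          w N * Real.log (Real.log N) * Real.log N ^ (3 / 2 : ℝ) ≤ (Y.card : ℝ) →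
          |edgeSum A X Y - 1 / 2 * ((X.card : ℝ) * (Y.card : ℝ))| ≤
            ε * ((X.card : ℝ) * (Y.card : ℝ))}

/-- The conclusion for a fixed density error `ε`. The sizes of the witnesses are `C * ℓ` and
`C * d` with `ℓ` about `log N`, `d` about `√ℓ` and `C` of order `ε⁻²`; the choice `d = √ℓ` balances
the energy bound for the part of `X` made of independent sets, of order `1 / d`, against the number
of subspaces of dimension `d`. -/
lemma eventually_regularWithError.{u} {w : ℕ → ℝ}
    (hw : Filter.Tendsto w Filter.atTop Filter.atTop) {ε : ℝ} (hε : 0 < ε) (hε1 : ε ≤ 1) :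
    ∀ᶠ N : ℕ in Filter.atTop, RegularWithError.{u} w ε N := by
  obtain ⟨C, hC⟩ := exists_nat_ge (192 / ε ^ 2)
  have hC192 : 192 ≤ ε ^ 2 * C := by
    rwa [div_le_iff₀ (by positivity), mul_comm] at hC
  have hC' : (192 : ℝ) ≤ C := by
    have : ε ^ 2 ≤ 1 := pow_le_one₀ hε.le hε1
    have : ε ^ 2 * (C : ℝ) ≤ 1 * C := by gcongr
    linarith
  have hC2 : 2 ≤ C := by
    have : (2 : ℝ) ≤ C := by linarith
    exact_mod_cast this
  have hM : 1 ≤ 12 * (C : ℝ) ^ 2 / ε := by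
    rw [le_div_iff₀ hε]
    nlinarith
  have hlogN : Filter.Tendsto (fun N : ℕ => Real.log N) Filter.atTop Filter.atTop :=
    Real.tendsto_log_atTop.comp tendsto_natCast_atTop_atTop
  filter_upwards [eventually_mul_log_le hw hM, hlogN.eventually_ge_atTop 1,
    Filter.eventually_ge_atTop 4] with N hN hL hN4 G _ _ hexp hcard
  classical
  have hself (g : G) : 2 • g = 0 := by
    rw [← hexp]
    exact AddMonoid.exponent_nsmul_eq_zero g
  let : AddCommGroup G :=
    { (inferInstance : AddGroup G) with
      add_comm := fun x y => add_comm_of_exponent_two hexp x y }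
  let : Module (ZMod 2) G := AddCommGroup.zmodModule hself
  let : Fintype G := Fintype.ofFinite G
  rw [Nat.card_eq_fintype_card] at hcard
  set L := Real.log N with hLdef
  set ℓ := ⌈L⌉₊ with hℓdef
  set d := ⌈√(ℓ : ℝ)⌉₊ with hddef
  have hN4' : (4 : ℝ) ≤ N := by exact_mod_cast hN4
  have hLℓ : L ≤ ℓ := Nat.le_ceil _
  have hℓ1 : (1 : ℝ) ≤ ℓ := hL.trans hLℓ
  have hℓ1' : 1 ≤ ℓ := by exact_mod_cast hℓ1
  have hℓL : (ℓ : ℝ) ≤ 2 * L := by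
    have := Nat.ceil_lt_add_one (show 0 ≤ L by linarith)
    linarith
  have hNℓ : (N : ℝ) ≤ Real.exp ℓ := by
    rw [← Real.exp_log (show (0 : ℝ) < N by linarith)]
    exact Real.exp_le_exp.2 hLℓ
  have hsL1 : 1 ≤ √L := Real.one_le_sqrt.2 hL
  have hsqL : √L * √L = L := Real.mul_self_sqrt (by linarith)
  have hLd : √L ≤ d := (Real.sqrt_le_sqrt hLℓ).trans (Nat.le_ceil _)
  have hd : 0 < d := by
    have : (0 : ℝ) < d := by linarith
    exact_mod_cast this
  have hdℓ : d ≤ ℓ := by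
    refine Nat.ceil_le.2 (Real.sqrt_le_left (by linarith) |>.2 ?_)
    nlinarith
  have hdL : (d : ℝ) ≤ 3 * √L := by
    have h1 := Nat.ceil_lt_add_one (Real.sqrt_nonneg (ℓ : ℝ))
    have h2 : √(ℓ : ℝ) ≤ 2 * √L := by
      refine Real.sqrt_le_left (by positivity) |>.2 ?_
      nlinarith
    linarith
  set P := L ^ (3 / 2 : ℝ) with hPdef
  have hP : P = L * √L := by
    rw [hPdef, Real.sqrt_eq_rpow, ← Real.rpow_one_add' (by linarith) (by norm_num)]
    norm_num
  have hkey := randomSubset_correlated_le (V := G) hε hC192 hC2 hd hdℓ (by rwa [hcard])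
    (fun k => w N * Real.log L * P ≤ (k : ℝ)) (by
      intro k hk
      obtain ⟨hk1, hk2⟩ := hN k hk
      have hlogk : 0 ≤ Real.log k := Real.log_nonneg hk1
      have hk3 : 12 * (C : ℝ) ^ 2 * P * (1 + 3 * Real.log k) ≤ ε * k := by
        have h1 : 12 * (C : ℝ) ^ 2 / ε * P * (1 + 3 * Real.log k) =
          12 * (C : ℝ) ^ 2 * P * (1 + 3 * Real.log k) / ε := by ring
        rwa [h1, div_le_iff₀ hε, mul_comm (k : ℝ)] at hk2
      have hP0 : 0 ≤ P := by rw [hP]; positivity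
      have hk4 : 12 * (C : ℝ) ^ 2 * P ≤ ε * k := by
        refine le_trans ?_ hk3
        exact le_mul_of_one_le_right (by positivity) (by linarith)
      have hab : (C * ℓ : ℝ) * (C * d) ≤ ε / 2 * k := by
        calc (C * ℓ : ℝ) * (C * d) ≤ (C * (2 * L)) * (C * (3 * √L)) := by gcongr
          _ = 12 * (C : ℝ) ^ 2 * P / 2 := by rw [hP]; ring
          _ ≤ ε * k / 2 := by gcongr
          _ = ε / 2 * k := by ring
      have ha : (C * ℓ : ℝ) ≤ ε * k := by
        have h1 : (1 : ℝ) ≤ C * d := by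
          have h2 : (1 : ℝ) ≤ d := by exact_mod_cast hd
          nlinarith
        have h2 : (C * ℓ : ℝ) ≤ C * ℓ * (C * d) := le_mul_of_one_le_right (by positivity) h1
        have h3 : (0 : ℝ) ≤ ε * k := by positivity
        linarith
      push_cast
      refine ⟨ha, ?_, ?_, hab⟩
      · have : (C * ℓ : ℝ) ≤ k := ha.trans (mul_le_of_le_one_left (by positivity) hε1)
        exact_mod_cast this
      · calc (C * ℓ : ℝ) ^ 2 * (1 + 3 * Real.log k)
            ≤ (C * (2 * L)) ^ 2 * (1 + 3 * Real.log k) := by gcongr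
          _ = √L * (4 * (C : ℝ) ^ 2 * P * (1 + 3 * Real.log k)) := by
              have : L ^ 2 = √L * (L * √L) := by rw [mul_left_comm, hsqL, sq]
              rw [mul_pow, mul_pow, this, hP]
              ring
          _ ≤ √L * (ε / 2 * k) := by
              refine mul_le_mul_of_nonneg_left ?_ (Real.sqrt_nonneg L)
              have : 0 ≤ (C : ℝ) ^ 2 * P * (1 + 3 * Real.log k) := by positivity
              linarith
          _ = ε / 2 * (√L * k) := by ring
          _ ≤ ε / 2 * (d * k) := by gcongr)
  set bad : Set (Set G) := {A | ∃ X Y : Finset G, w N * Real.log L * P ≤ (X.card : ℝ) ∧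
    w N * Real.log L * P ≤ (Y.card : ℝ) ∧ 2 * ε * (X.card * Y.card) ≤ |signSum A X Y|} with hbad
  have hbadN : (randomSubset G).real bad ≤ 1 / N := by
    refine hkey.trans ?_
    have h1 : Real.exp (-(2 * ℓ)) = (Real.exp ℓ * Real.exp ℓ)⁻¹ := by
      rw [Real.exp_neg, ← Real.exp_add, two_mul]
    have h2 : (4 : ℝ) * N ≤ Real.exp ℓ * Real.exp ℓ := by
      have : (N : ℝ) * N ≤ Real.exp ℓ * Real.exp ℓ := by gcongr
      nlinarith
    rw [h1, ← div_eq_mul_inv, div_le_div_iff₀ (by positivity) (by linarith)]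
    linarith
  have huniv : (1 : ℝ) ≤ (randomSubset G).real badᶜ + (randomSubset G).real bad := by
    have h1 := MeasureTheory.measureReal_union_le (μ := randomSubset G) badᶜ bad
    rwa [Set.compl_union_self, MeasureTheory.probReal_univ] at h1
  refine le_trans (by linarith) (MeasureTheory.measureReal_mono (s₁ := badᶜ) ?_
    (MeasureTheory.measure_ne_top _ _))
  intro A hA X Y hX hY
  rw [edgeSum_sub, abs_mul, abs_of_pos (by norm_num : (0 : ℝ) < 1 / 2)]
  by_contra! h
  exact hA ⟨X, Y, hX, hY, by linarith⟩

/-- A property which holds eventually for every fixed error `1 / (j + 1)` holds eventually for an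
error which tends to zero. -/
lemma exists_tendsto_zero_of_eventually {Q : ℝ → ℕ → Prop}
    (hQ : ∀ j : ℕ, ∀ᶠ N in Filter.atTop, Q (1 / ((j : ℝ) + 1)) N) :
    ∃ δ : ℕ → ℝ, Filter.Tendsto δ Filter.atTop (nhds 0) ∧ ∀ᶠ N in Filter.atTop, Q (δ N) N := by
  classical
  set f : ℕ → ℕ := fun N => Nat.findGreatest (fun j => Q (1 / ((j : ℝ) + 1)) N) N with hf
  refine ⟨fun N => 1 / ((f N : ℝ) + 1), ?_, ?_⟩
  · refine tendsto_one_div_add_atTop_nhds_zero_nat.comp (Filter.tendsto_atTop.2 fun j => ?_)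
    filter_upwards [hQ j, Filter.eventually_ge_atTop j] with N hN hjN
    exact Nat.le_findGreatest hjN hN
  · filter_upwards [hQ 0] with N hN
    exact Nat.findGreatest_spec (P := fun j : ℕ => Q (1 / ((j : ℝ) + 1)) N) (Nat.zero_le N) hN

theorem theorem7 (w : ℕ → ℝ) (hw : Filter.Tendsto w Filter.atTop Filter.atTop) :
    ∃ δ η : ℕ → ℝ,
      Filter.Tendsto δ Filter.atTop (nhds 0) ∧ Filter.Tendsto η Filter.atTop (nhds 0) ∧
      ∀ (G : Type*) [AddGroup G] [Finite G], AddMonoid.exponent G = 2 →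
        1 - η (Nat.card G) ≤ (randomSubset G).real
          {A : Set G | ∀ X Y : Finset G,
            w (Nat.card G) * Real.log (Real.log (Nat.card G)) *
                Real.log (Nat.card G) ^ (3 / 2 : ℝ) ≤ (X.card : ℝ) →
            w (Nat.card G) * Real.log (Real.log (Nat.card G)) *
                Real.log (Nat.card G) ^ (3 / 2 : ℝ) ≤ (Y.card : ℝ) →
            |edgeSum A X Y - 1 / 2 * ((X.card : ℝ) * (Y.card : ℝ))| ≤
              δ (Nat.card G) * ((X.card : ℝ) * (Y.card : ℝ))} := by
  classical
  obtain ⟨δ, hδ, hδQ⟩ := exists_tendsto_zero_of_eventually fun j : ℕ =>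
    eventually_regularWithError hw (ε := 1 / ((j : ℝ) + 1)) (by positivity)
      (by rw [div_le_one (by positivity)]; linarith [(Nat.cast_nonneg j : (0 : ℝ) ≤ j)])
  obtain ⟨N₀, hN₀⟩ := Filter.eventually_atTop.1 hδQ
  refine ⟨δ, fun N => if N₀ ≤ N then 1 / (N : ℝ) else 1, hδ, ?_, ?_⟩
  · refine tendsto_one_div_atTop_nhds_zero_nat.congr' ?_
    filter_upwards [Filter.eventually_ge_atTop N₀] with N hN
    rw [if_pos hN]
  · intro G _ _ hexp
    by_cases h : N₀ ≤ Nat.card G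
    · simp only [if_pos h]
      exact hN₀ _ h G hexp rfl
    · simp only [if_neg h, sub_self]
      exact MeasureTheory.measureReal_nonneg
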